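/- All graphs are finite, simple and undirected. For a graph $G$ and $A\subseteq V(G)$, let $N_G(A)$ be the set of vertices outside $A$ that have a neighbour in $A$. A graph $H$ is a minor of $G$ if a graph isomorphic to $H$ can be obtained from $G$ by deleting vertices and edges and contracting edges (equivalently, there are pairwise disjoint non-empty connected vertex sets of $G$, one for each vertex of $H$, such that the sets belonging to adjacent vertices of $H$ are joined by an edge of $G$). Two colorings are equivalent if they induce the same partition into color classes. For a vertex coloring $\chi_V$ of $G$, the $2$-dimensional Weisfeiler–Leman algorithm colors the pairs $(v_1,v_2)\in V(G)^2$ as follows. Initially, $(v_1,v_2)$ and $(v_1',v_2')$ get the same color if and only if, for all $i,j\in\{1,2\}$, we have $v_i=v_j\Leftrightarrow v_i'=v_j'$, $v_iv_j\in E(G)\Leftrightarrow v_i'v_j'\in E(G)$, and $\chi_V(v_i)=\chi_V(v_i')$. In each round a coloring $c$ is replaced by the coloring $$(v_1,v_2)\mapsto \big(c(v_1,v_2),\ \{\!\{(c(w,v_2),c(v_1,w)) : w\in V(G)\}\!\}\big),$$ until the partition no longer changes; the resulting coloring is denoted $\mathrm{WL}_2[G,\chi_V]$. For $X\subseteq V(G)$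 let $\chi_0$ be the vertex coloring in which every vertex of $X$ has its own private color and all vertices outside $X$ have one common further color. For $i\ge 0$ let $\chi_{2i+1}(v)=\mathrm{WL}_2[G,\chi_{2i}](v,v)$, and let $\chi_{2i+2}$ be obtained from $\chi_{2i+1}$ by giving each vertex that lies in a color class of $\chi_{2i+1}$ of size at most $2$ its own private color. Let $\chi=\chi_n$ for the least $n$ such that $\chi_n,\chi_{n+1},\chi_{n+2}$ are pairwise equivalent, that is, neither of the two operations changes the partition. The $(2,2)$-closure $\mathrm{cl}_{2,2}^G(X)$ is the set of all vertices whose color class under $\chi$ is a singleton. Lemma. Let $h\ge 0$ be an integer and let $G$ be a graph that excludes $K_{3,h}$ as a minor. Let $X\subseteq V(G)$ and $D=\mathrm{cl}_{2,2}^G(X)$. Then (the vertex set of) every connected component $Z$ of $G-D$ satisfies $|N_G(Z)|<h$. -/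

import Mathlib

universe u

/-- `N_G(A)`: the vertices outside `A` that are adjacent to some vertex of `A`. -/
def SimpleGraph.openNbhd {V : Type u} (G : SimpleGraph V) (A : Set V) : Set V :=
  {v | v ∉ A ∧ ∃ a ∈ A, G.Adj a v}

/-- `H` is a minor of `G`: there are pairwise disjoint non-empty connected vertex sets
(branch sets) in `G`, one for each vertex of `H`, such that the branch sets of adjacent
vertices of `H` are joined by an edge of `G`. -/
def SimpleGraph.HasMinor {V : Type*} {W : Type*} (G : SimpleGraph V) (H : SimpleGraph W) : Prop :=
  ∃ B : W → Set V,
    (∀ a, (G.induce (B a)).Connected) ∧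
    (∀ a b, a ≠ b → Disjoint (B a) (B b)) ∧
    (∀ a b, H.Adj a b → ∃ x ∈ B a, ∃ y ∈ B b, G.Adj x y)

namespace WL

/-- A coloring of the elements of `α` by some set of colors. -/
structure Coloring (α : Type u) where
  Color : Type u
  color : α → Color

namespace Coloring

/-- `χ₁` refines `χ₂`. -/
def Refines {α : Type u} (χ₁ χ₂ : Coloring α) : Prop :=
  ∀ v w, χ₁.color v = χ₁.color w → χ₂.color v = χ₂.color w

/-- `χ₁` and `χ₂` induce the same partition into color classes. -/
def Equivalent {α : Type u} (χ₁ χ₂ : Coloring α) : Prop :=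
  χ₁.Refines χ₂ ∧ χ₂.Refines χ₁

/-- The color class of `v`. -/
def cls {α : Type u} (χ : Coloring α) (v : α) : Set α :=
  {w | χ.color w = χ.color v}

/-- On a finite set, a sequence of successively refining colorings becomes stationary.
(So the minimal indices taken below are minima of non-empty sets.) -/
theorem exists_stationary {α : Type u} [Finite α] (s : ℕ → Coloring α)
    (hs : ∀ i, (s (i + 1)).Refines (s i)) :
    ∃ n, ∀ m, n ≤ m → (s n).Equivalent (s m) := by
  let f : ℕ → Setoid α := fun i => Setoid.ker (s i).color
  have hf : Antitone f := antitone_nat_of_succ_le fun i v w h => hs i v w h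
  have : Finite (Setoid α) :=
    Finite.of_injective (fun r : Setoid α => (fun x y => r x y : α → α → Prop))
      (fun a b h => Setoid.ext fun x y => iff_of_eq (congrFun (congrFun h x) y))
  obtain ⟨n, hn⟩ := WellFoundedGT.monotone_chain_condition
    (⟨fun i => OrderDual.toDual (f i), fun i j h => hf h⟩ : ℕ →o (Setoid α)ᵒᵈ)
  refine ⟨n, fun m hm => ?_⟩
  have h : f n = f m := congrArg OrderDual.ofDual (hn m hm)
  refine ⟨fun v w hvw => ?_, fun v w hvw => ?_⟩
  · have : f n v w := hvw
    rw [h] at this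
    exact this
  · have : f m v w := hvw
    rw [← h] at this
    exact this

end Coloring

/-- The initial coloring of `k`-tuples in a vertex-colored graph: two tuples receive the same
color iff they have the same equality pattern, the same adjacency pattern and the same
vertex colors. -/
def init {V : Type u} (k : ℕ) (G : SimpleGraph V) (χV : Coloring V) : Coloring (Fin k → V) where
  Color := (Fin k → Fin k → Prop × Prop) × (Fin k → χV.Color)
  color v := (fun i j => (v i = v j, G.Adj (v i) (v j)), fun i => χV.color (v i))

/-- One round of `k`-dimensional Weisfeiler-Leman, `k ≥ 2`: the new color of `v` is its old color
together with the multiset, over all vertices `w`, of the `k`-tuples of the old colors of the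
tuples `v[w/1], …, v[w/k]`. -/
def round {V : Type u} [Fintype V] (k : ℕ) (χ : Coloring (Fin k → V)) :
    Coloring (Fin k → V) where
  Color := χ.Color × Multiset (Fin k → χ.Color)
  color v :=
    (χ.color v, (Finset.univ : Finset V).val.map fun w i => χ.color (Function.update v i w))

/-- The coloring after `i` rounds of `k`-WL, `k ≥ 2`. -/
def iter {V : Type u} [Fintype V] (k : ℕ) (G : SimpleGraph V) (χV : Coloring V) :
    ℕ → Coloring (Fin k → V)
  | 0 => init k G χV
  | i + 1 => round k (iter k G χV i)

/-- The `k`-stable coloring, `k ≥ 2`, of the vertex-colored graph `(G, χV)`: the coloring after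
`i` rounds, for the least `i` such that the next round gives an equivalent coloring. -/
noncomputable def stable {V : Type u} [Fintype V] (k : ℕ) (G : SimpleGraph V) (χV : Coloring V) :
    Coloring (Fin k → V) :=
  iter k G χV (sInf {i | (iter k G χV i).Equivalent (iter k G χV (i + 1))})

/-- The vertex coloring `v ↦ WL_k(G, χV)(v, …, v)`. -/
noncomputable def diagStep {V : Type u} [Fintype V] (k : ℕ) (G : SimpleGraph V)
    (χV : Coloring V) : Coloring V where
  Color := (stable k G χV).Color
  color v := (stable k G χV).color fun _ => v

open Classical in
/-- All vertices in color classes of size at most `t` receive their own color. -/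
noncomputable def splitStep {V : Type u} (t : ℕ) (χ : Coloring V) : Coloring V where
  Color := V ⊕ χ.Color
  color v := if (χ.cls v).ncard ≤ t then Sum.inl v else Sum.inr (χ.color v)

open Classical in
/-- The sequence `χ₀, χ₁, χ₂, …` of vertex colorings with `χ₀ = χV`, where `χ_{2i+1}` is obtained
from `χ_{2i}` by `k`-WL and `χ_{2i+2}` from `χ_{2i+1}` by splitting the classes of size `≤ t`. -/
noncomputable def tkSeq {V : Type u} [Fintype V] (t k : ℕ) (G : SimpleGraph V)
    (χV : Coloring V) : ℕ → Coloring V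
  | 0 => χV
  | n + 1 => if Even n then diagStep k G (tkSeq t k G χV n) else splitStep t (tkSeq t k G χV n)

/-- The `(t,k)`-WL-stable coloring: the first `χ_n` that is changed neither by `k`-WL nor by
splitting small classes (one of the two produces `χ_{n+1}`, the other `χ_{n+2}`). -/
noncomputable def tkStable {V : Type u} [Fintype V] (t k : ℕ) (G : SimpleGraph V)
    (χV : Coloring V) : Coloring V :=
  tkSeq t k G χV (sInf {n |
    (tkSeq t k G χV n).Equivalent (tkSeq t k G χV (n + 1)) ∧
    (tkSeq t k G χV (n + 1)).Equivalent (tkSeq t k G χV (n + 2))})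

open Classical in
/-- The vertex coloring in which every vertex of `X` has its own color and all other vertices
share one further color. -/
noncomputable def individualize {V : Type u} (X : Set V) : Coloring V where
  Color := Option V
  color v := if v ∈ X then some v else none

/-- The `(t,k)`-closure of `X` in `G`: the vertices in singleton classes of the
`(t,k)`-WL-stable coloring after individualizing all vertices of `X`. -/
def closure {V : Type u} [Fintype V] (t k : ℕ) (G : SimpleGraph V) (X : Set V) : Set V :=
  {v | ((tkStable t k G (individualize X)).cls v).ncard = 1}

end WL

/-! The stable coloring is equitable, vertices of `D` are alone in their classes, and all other
classes have size at least 3. Let `Q` be the set of colors on `Z`. It suffices to find three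
disjoint connected sets with colors in `Q`, each meeting every class in `Q`. They may leave `Z`: a
vertex `y` of `N(Z)` is a singleton class, so by equitability every vertex colored like a neighbour
of `y` is adjacent to `y`. The three sets and `h` such vertices then form a `K_{3,h}` minor.

The sets start as three vertices of a smallest class in `Q`, of size `m`, and grow class by class.
The invariant is that any `k ≥ 1` of them jointly occupy more than a fraction `(k - 1)/m` of each
class reached. Biregularity preserves density when passing to neighbours in an adjacent class
(`IsEquitable.card_mul_card_le`), and Rado's lemma makes the neighbourhoods disjoint without losing
the bounds. -/

/-- **Rado's refinement lemma** for families of finite sets: if all unions satisfy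
`g I ≤ #(⋃ i ∈ I, A i)` for a supermodular `g`, then the sets can be shrunk to pairwise
disjoint ones still satisfying these inequalities. -/
theorem Finset.exists_disjoint_subfamily_of_supermodular {ι α : Type*} [Fintype ι]
    [DecidableEq ι] [DecidableEq α] (g : Finset ι → ℕ)
    (hg : ∀ I J, g I + g J ≤ g (I ∪ J) + g (I ∩ J)) (A : ι → Finset α)
    (hA : ∀ I, g I ≤ (I.biUnion A).card) :
    ∃ S : ι → Finset α, (∀ i, S i ⊆ A i) ∧ Pairwise (fun i j => Disjoint (S i) (S j)) ∧
      ∀ I, g I ≤ (I.biUnion S).card := by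
  induction hn : ∑ i, (A i).card using Nat.strong_induction_on generalizing A with
  | _ n ih =>
  subst hn
  by_cases hdis : Pairwise (fun i j => Disjoint (A i) (A j))
  · exact ⟨A, fun i => subset_rfl, hdis, hA⟩
  simp only [Pairwise, not_forall, Finset.not_disjoint_iff] at hdis
  obtain ⟨i, j, hij, u, hui, huj⟩ := hdis
  have shrink : ∀ k, u ∈ A k →
      (∀ I, g I ≤ (I.biUnion (Function.update A k ((A k).erase u))).card) →
      ∃ S : ι → Finset α, (∀ i, S i ⊆ A i) ∧ Pairwise (fun i j => Disjoint (S i) (S j)) ∧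
        ∀ I, g I ≤ (I.biUnion S).card := by
    intro k huk hk
    have hsub : ∀ l, Function.update A k ((A k).erase u) l ⊆ A l := by
      intro l
      by_cases hl : l = k
      · subst hl; simpa using Finset.erase_subset u (A l)
      · simp [hl]
    obtain ⟨S, hS, hd, hc⟩ := ih _
      (Finset.sum_lt_sum (fun l _ => Finset.card_le_card (hsub l))
        ⟨k, Finset.mem_univ k, by simpa using Finset.card_erase_lt_of_mem huk⟩) _ hk rfl
    exact ⟨S, fun l => (hS l).trans (hsub l), hd, hc⟩
  -- Deleting `u` lowers a union by at most one. An inequality it destroys was therefore an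
  -- equality, and `A k` alone contributed `u` to that union.
  have tight : ∀ k, u ∈ A k →
      (¬ ∀ I, g I ≤ (I.biUnion (Function.update A k ((A k).erase u))).card) →
      ∃ I : Finset ι, k ∈ I ∧ (∀ l ∈ I, u ∈ A l → l = k) ∧ (I.biUnion A).card = g I := by
    intro k huk hk
    push Not at hk
    obtain ⟨I, hI⟩ := hk
    have hsup : (I.biUnion A).erase u ⊆
        I.biUnion (Function.update A k ((A k).erase u)) := by
      intro x hx
      obtain ⟨hxu, l, hl, hxl⟩ : x ≠ u ∧ ∃ l ∈ I, x ∈ A l := by simpa using hx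
      refine Finset.mem_biUnion.2 ⟨l, hl, ?_⟩
      by_cases hlk : l = k
      · subst hlk; simpa using ⟨hxu, hxl⟩
      · simpa [hlk] using hxl
    have hu : u ∉ I.biUnion (Function.update A k ((A k).erase u)) := by
      intro hu
      have : I.biUnion A ⊆ I.biUnion (Function.update A k ((A k).erase u)) := by
        intro x hx
        by_cases hxu : x = u
        · exact hxu ▸ hu
        · exact hsup (Finset.mem_erase.2 ⟨hxu, hx⟩)
      exact absurd ((hA I).trans (Finset.card_le_card this)) (not_le.2 hI)
    have hkI : k ∈ I := by
      by_contra hkI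
      have : I.biUnion (Function.update A k ((A k).erase u)) = I.biUnion A := by
        refine Finset.biUnion_congr rfl fun l hl => ?_
        have hlk : l ≠ k := by rintro rfl; exact hkI hl
        rw [Function.update_of_ne hlk]
      rw [this] at hI
      exact absurd (hA I) (not_le.2 hI)
    refine ⟨I, hkI, fun l hl hul => ?_, le_antisymm ?_ (hA I)⟩
    · by_contra hlk
      exact hu (Finset.mem_biUnion.2 ⟨l, hl, by simpa [hlk] using hul⟩)
    · have h1 := Finset.card_le_card hsup
      have h2 := Finset.pred_card_le_card_erase (s := I.biUnion A) (a := u)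
      omega
  by_cases hi : ∀ I, g I ≤ (I.biUnion (Function.update A i ((A i).erase u))).card
  · exact shrink i hui hi
  by_cases hj : ∀ I, g I ≤ (I.biUnion (Function.update A j ((A j).erase u))).card
  · exact shrink j huj hj
  exfalso
  obtain ⟨I, hiI, hIu, hIc⟩ := tight i hui hi
  obtain ⟨J, hjJ, hJu, hJc⟩ := tight j huj hj
  -- Uncrossing: `u` lies in both tight unions but not in the union over `I ∩ J`, so submodularity
  -- of the union size is strict here, contradicting supermodularity of `g`.
  have hinter : insert u ((I ∩ J).biUnion A) ⊆ I.biUnion A ∩ J.biUnion A := by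
    intro x hx
    rcases Finset.mem_insert.1 hx with rfl | hx
    · exact Finset.mem_inter.2
        ⟨Finset.mem_biUnion.2 ⟨i, hiI, hui⟩, Finset.mem_biUnion.2 ⟨j, hjJ, huj⟩⟩
    · obtain ⟨l, hl, hxl⟩ := Finset.mem_biUnion.1 hx
      rw [Finset.mem_inter] at hl
      exact Finset.mem_inter.2
        ⟨Finset.mem_biUnion.2 ⟨l, hl.1, hxl⟩, Finset.mem_biUnion.2 ⟨l, hl.2, hxl⟩⟩
  have hu : u ∉ (I ∩ J).biUnion A := by
    intro hu
    obtain ⟨l, hl, hul⟩ := Finset.mem_biUnion.1 hu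
    rw [Finset.mem_inter] at hl
    exact hij ((hIu l hl.1 hul).symm.trans (hJu l hl.2 hul))
  have h1 := Finset.card_le_card hinter
  rw [Finset.card_insert_of_notMem hu] at h1
  have h2 := Finset.card_union_add_card_inter (I.biUnion A) (J.biUnion A)
  rw [← Finset.union_biUnion] at h2
  have h3 := hg I J
  have h4 := hA (I ∪ J)
  have h5 := hA (I ∩ J)
  omega

/-! ### Equitable colorings and disjoint connected sets -/

namespace SimpleGraph

theorem connected_induce_singleton {V : Type*} {G : SimpleGraph V} (v : V) :
    (G.induce {v}).Connected :=
  ⟨Preconnected.of_subsingleton⟩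

theorem induce_union_connected_of_forall_adj {V : Type*} {G : SimpleGraph V} {s t : Set V}
    (hs : (G.induce s).Connected) (ht : ∀ w ∈ t, ∃ v ∈ s, G.Adj v w) :
    (G.induce (s ∪ t)).Connected := by
  obtain ⟨u, hu⟩ := hs.nonempty
  refine induce_connected_of_patches u (Or.inl hu) ?_
  rintro v (hv | hv)
  · exact ⟨s, Set.subset_union_left, hu, hv, hs.preconnected _ _⟩
  · obtain ⟨x, hx, hxv⟩ := ht v hv
    have hc : (G.induce (s ∪ {v})).Connected :=
      connected_induce_union hs.preconnected
        (Preconnected.of_subsingleton) hx (Set.mem_singleton v) hxv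
    exact ⟨s ∪ {v}, Set.union_subset_union_right s (Set.singleton_subset_iff.2 hv), Or.inl hu,
      Or.inr rfl, hc.preconnected _ _⟩

open Classical in
/-- Vertices of the same color have equally many neighbors of each color. -/
def IsEquitable {V κ : Type*} [Fintype V] (G : SimpleGraph V) (f : V → κ) : Prop :=
  ∀ u u', f u = f u' → ∀ d, (Finset.univ.filter fun w => f w = d ∧ G.Adj u w).card =
    (Finset.univ.filter fun w => f w = d ∧ G.Adj u' w).card

open Classical in
/-- The finite set of vertices of color `c`. -/
noncomputable def colorFinset {V κ : Type*} [Fintype V] (f : V → κ) (c : κ) : Finset V :=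
  Finset.univ.filter fun w => f w = c

@[simp]
theorem mem_colorFinset {V κ : Type*} [Fintype V] {f : V → κ} {c : κ} {v : V} :
    v ∈ colorFinset f c ↔ f v = c := by
  simp [colorFinset]

section Equitable

variable {V κ : Type*} [Fintype V] {G : SimpleGraph V} {f : V → κ}

theorem IsEquitable.exists_adj (hf : G.IsEquitable f) {u u' v : V} (h : f u = f u')
    (hv : G.Adj u v) : ∃ v', f v' = f v ∧ G.Adj u' v' := by
  classical
  have h1 := hf u u' h (f v)
  have h2 : 0 < (Finset.univ.filter fun w => f w = f v ∧ G.Adj u w).card :=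
    Finset.card_pos.2 ⟨v, by simpa using hv⟩
  rw [h1] at h2
  obtain ⟨v', hv'⟩ := Finset.card_pos.1 h2
  exact ⟨v', by simpa using hv'⟩

open Classical in
/-- Between two adjacent color classes of an equitable coloring, the neighborhood of a set has
at least the density of the set. -/
theorem IsEquitable.card_mul_card_le (hf : G.IsEquitable f) {u v : V} (huv : G.Adj u v)
    {S : Finset V} (hS : S ⊆ colorFinset f (f u)) :
    S.card * (colorFinset f (f v)).card ≤
      ((colorFinset f (f v)).filter fun w => ∃ s ∈ S, G.Adj s w).card *
        (colorFinset f (f u)).card := by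
  set C := colorFinset f (f u)
  set D := colorFinset f (f v)
  set N := D.filter fun w => ∃ s ∈ S, G.Adj s w
  set r := (Finset.univ.filter fun w => f w = f v ∧ G.Adj u w).card
  set s := (Finset.univ.filter fun w => f w = f u ∧ G.Adj v w).card
  have hr : 0 < r := Finset.card_pos.2 ⟨v, by simpa using huv⟩
  have habove : ∀ a ∈ C, (D.bipartiteAbove G.Adj a).card = r := by
    intro a ha
    refine Eq.trans ?_ (hf a u (mem_colorFinset.1 ha) (f v))
    congr 1
    ext w
    simp [D]
  have hbelow : ∀ b ∈ D, (C.bipartiteBelow G.Adj b).card = s := by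
    intro b hb
    refine Eq.trans ?_ (hf b v (mem_colorFinset.1 hb) (f u))
    congr 1
    ext w
    simp [C, G.adj_comm]
  -- All edges between the two classes are counted from both sides; below, only those leaving `S`,
  -- all of which end in `N`.
  have h1 : C.card * r = D.card * s :=
    Finset.card_mul_eq_card_mul G.Adj habove hbelow
  have h2 : S.card * r ≤ N.card * s := by
    refine Finset.card_mul_le_card_mul G.Adj (fun a ha => ?_) fun b hb => ?_
    · rw [← habove a (hS ha)]
      refine Finset.card_le_card fun w hw => ?_
      rw [Finset.mem_bipartiteAbove] at hw ⊢
      exact ⟨Finset.mem_filter.2 ⟨hw.1, a, ha, hw.2⟩, hw.2⟩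
    · rw [← hbelow b (Finset.mem_filter.1 hb).1]
      exact Finset.card_le_card (Finset.filter_subset_filter _ hS)
  refine Nat.le_of_mul_le_mul_right ?_ hr
  calc S.card * D.card * r = S.card * r * D.card := by ring
    _ ≤ N.card * s * D.card := Nat.mul_le_mul_right _ h2
    _ = N.card * (D.card * s) := by ring
    _ = N.card * C.card * r := by rw [← h1]; ring

/-- With `q = n / m`, the values by cardinality are `0`, `1`, `q + 1` and `2 * n / m + 1`. They
suffice because `q ≥ 1` (for disjoint sets) and `2 * q ≤ 2 * n / m` (for overlapping pairs). -/
theorem threshold_supermodular {n m : ℕ} (hm : 0 < m) (hmn : m ≤ n)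
    (I J : Finset (Fin 3)) :
    let g : Finset (Fin 3) → ℕ := fun I => if I = ∅ then 0 else (I.card - 1) * n / m + 1
    g I + g J ≤ g (I ∪ J) + g (I ∩ J) := by
  intro g
  let φ : ℕ → ℕ := fun k => if k = 0 then 0 else (k - 1) * n / m + 1
  have hgφ : ∀ I, g I = φ I.card := fun I => by simp [g, φ, Finset.card_eq_zero]
  simp only [hgφ]
  have h1 := Finset.card_union_add_card_inter I J
  have h2 := Finset.card_le_card (Finset.inter_subset_left (s₁ := I) (s₂ := J))
  have h3 := Finset.card_le_card (Finset.inter_subset_right (s₁ := I) (s₂ := J))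
  have h4 : (I ∪ J).card ≤ 3 := by simpa using Finset.card_le_univ (I ∪ J)
  generalize (I ∪ J).card = a at *
  generalize (I ∩ J).card = b at *
  generalize I.card = i at *
  generalize J.card = j at *
  have hq : 1 ≤ n / m := (Nat.one_le_div_iff hm).2 hmn
  have hq2 : 2 * (n / m) ≤ 2 * n / m := Nat.mul_div_le_mul_div_assoc 2 n m
  have φ0 : φ 0 = 0 := rfl
  have φ1 : φ 1 = 1 := by simp [φ]
  have φ2 : φ 2 = n / m + 1 := by simp [φ]
  have φ3 : φ 3 = 2 * n / m + 1 := by simp [φ]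
  have hi : i ≤ 3 := by omega
  have hj : j ≤ 3 := by omega
  clear_value φ
  interval_cases i <;> interval_cases j <;> interval_cases a <;> first
    | omega
    | (interval_cases b <;> omega)

open Classical in
/-- Extending three disjoint connected sets into an adjacent color class. -/
theorem IsEquitable.exists_extension (hf : G.IsEquitable f) {m : ℕ} (hm : 0 < m) {u v : V}
    (huv : G.Adj u v) (hmv : m ≤ (colorFinset f (f v)).card) (H : Fin 3 → Finset V)
    (hH : ∀ I : Finset (Fin 3), I.Nonempty → (I.card - 1) * (colorFinset f (f u)).card <
      m * ((I.biUnion H).filter fun w => f w = f u).card) :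
    ∃ S : Fin 3 → Finset V, (∀ i, ∀ w ∈ S i, f w = f v ∧ ∃ s ∈ H i, G.Adj s w) ∧
      Pairwise (fun i j => Disjoint (S i) (S j)) ∧
      ∀ I : Finset (Fin 3), I.Nonempty → (I.card - 1) * (colorFinset f (f v)).card <
        m * (I.biUnion S).card := by
  let A : Fin 3 → Finset V := fun i =>
    (colorFinset f (f v)).filter fun w => ∃ s ∈ (H i).filter fun w => f w = f u, G.Adj s w
  obtain ⟨S, hSA, hSd, hSc⟩ := Finset.exists_disjoint_subfamily_of_supermodular _
    (threshold_supermodular hm hmv) A (fun I => by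
      rcases I.eq_empty_or_nonempty with rfl | hI
      · simp
      rw [if_neg hI.ne_empty, Nat.succ_le_iff, Nat.div_lt_iff_lt_mul hm]
      have hunion : I.biUnion A = (colorFinset f (f v)).filter fun w =>
          ∃ s ∈ (I.biUnion H).filter fun w => f w = f u, G.Adj s w := by
        ext w
        simp only [A, Finset.mem_biUnion, Finset.mem_filter]
        tauto
      have h1 := hf.card_mul_card_le huv (S := (I.biUnion H).filter fun w => f w = f u)
        fun w hw => mem_colorFinset.2 (Finset.mem_filter.1 hw).2
      rw [← hunion] at h1
      have hu : 0 < (colorFinset f (f u)).card := Finset.card_pos.2 ⟨u, by simp⟩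
      have hv : 0 < (colorFinset f (f v)).card := Finset.card_pos.2 ⟨v, by simp⟩
      refine Nat.lt_of_mul_lt_mul_right (a := (colorFinset f (f u)).card) ?_
      calc _ = (I.card - 1) * (colorFinset f (f u)).card * (colorFinset f (f v)).card := by ring
        _ < m * ((I.biUnion H).filter fun w => f w = f u).card *
            (colorFinset f (f v)).card := Nat.mul_lt_mul_of_pos_right (hH I hI) hv
        _ = m * (((I.biUnion H).filter fun w => f w = f u).card *
            (colorFinset f (f v)).card) := by ring
        _ ≤ m * ((I.biUnion A).card * (colorFinset f (f u)).card) := Nat.mul_le_mul_left _ h1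
        _ = _ := by ring)
  refine ⟨S, fun i w hw => ?_, hSd, fun I hI => ?_⟩
  · obtain ⟨h1, s, hs, hsw⟩ := Finset.mem_filter.1 (hSA i hw)
    exact ⟨mem_colorFinset.1 h1, s, (Finset.mem_filter.1 hs).1, hsw⟩
  · have := hSc I
    rw [if_neg hI.ne_empty, Nat.succ_le_iff, Nat.div_lt_iff_lt_mul hm] at this
    rwa [mul_comm m]

/-- In an equitable coloring, for a set `Q` of colors with classes of size at least three that is
connected in the quotient graph, there are three pairwise disjoint connected sets of vertices with
colors in `Q`, each of which meets all color classes in `Q`. -/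
theorem IsEquitable.exists_three_connected (hf : G.IsEquitable f) (Q : Finset κ)
    (hQ : Q.Nonempty) (h3 : ∀ c ∈ Q, 3 ≤ (colorFinset f c).card)
    (hconn : ∀ P ⊆ Q, P ≠ Q → P.Nonempty → ∃ u v, G.Adj u v ∧ f u ∈ P ∧ f v ∈ Q ∧ f v ∉ P) :
    ∃ H : Fin 3 → Finset V, (∀ i, (G.induce (H i : Set V)).Connected) ∧
      Pairwise (fun i j => Disjoint (H i) (H j)) ∧ (∀ i, ∀ v ∈ H i, f v ∈ Q) ∧
      ∀ i, ∀ c ∈ Q, ∃ v ∈ H i, f v = c := by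
  classical
  -- Minimality supplies `m ≤ n` for the threshold function in every later class.
  obtain ⟨a, haQ, hamin⟩ := Q.exists_min_image (fun c => (colorFinset f c).card) hQ
  set m := (colorFinset f a).card
  have hm3 : 3 ≤ m := h3 a haQ
  have grow : ∀ k, 1 ≤ k → k ≤ Q.card → ∃ P ⊆ Q, P.card = k ∧ ∃ H : Fin 3 → Finset V,
      (∀ i, (G.induce (H i : Set V)).Connected) ∧
      Pairwise (fun i j => Disjoint (H i) (H j)) ∧ (∀ i, ∀ v ∈ H i, f v ∈ P) ∧
      ∀ c ∈ P, ∀ I : Finset (Fin 3), I.Nonempty → (I.card - 1) * (colorFinset f c).card <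
        m * ((I.biUnion H).filter fun w => f w = c).card := by
    intro k hk
    induction k, hk using Nat.le_induction with
    | base =>
      intro _
      obtain ⟨x⟩ : Nonempty (Fin 3 ↪ colorFinset f a) :=
        Function.Embedding.nonempty_of_card_le (by rwa [Fintype.card_coe, Fintype.card_fin])
      have hx : ∀ i, f (x i) = a := fun i => mem_colorFinset.1 (x i).2
      refine ⟨{a}, by simpa using haQ, by simp, fun i => {(x i : V)}, fun i => ?_, ?_, ?_, ?_⟩
      · rw [Finset.coe_singleton]
        exact connected_induce_singleton _
      · intro i j hij
        simpa [Subtype.ext_iff] using fun h => hij (x.injective (Subtype.ext h))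
      · simpa using hx
      · intro c hc I hI
        rw [Finset.mem_singleton] at hc
        subst hc
        have hfil : ((I.biUnion fun i => {(x i : V)}).filter fun w => f w = c) =
            I.image fun i => (x i : V) := by
          rw [Finset.biUnion_singleton, Finset.filter_true_of_mem]
          intro w hw
          obtain ⟨i, -, rfl⟩ := Finset.mem_image.1 hw
          exact hx i
        rw [hfil, Finset.card_image_of_injective I
          (f := fun i => (x i : V)) (Subtype.val_injective.comp x.injective),
          mul_comm]
        have := hI.card_pos
        exact Nat.mul_lt_mul_of_pos_left (by omega) (by omega)
    | succ k hk ih =>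
      intro hkQ
      obtain ⟨P, hPQ, hPk, H, hHc, hHd, hHP, hHm⟩ := ih (by omega)
      obtain ⟨u, v, huv, huP, hvQ, hvP⟩ := hconn P hPQ (by rintro rfl; omega)
        (Finset.card_pos.1 (by omega))
      obtain ⟨S, hSH, hSd, hSm⟩ :=
        hf.exists_extension (by omega) huv (hamin _ hvQ) H (hHm _ huP)
      have hHS : ∀ i j, Disjoint (H i) (S j) := fun i j =>
        Finset.disjoint_left.2 fun w hw hw' => hvP ((hSH j w hw').1 ▸ hHP i w hw)
      refine ⟨insert (f v) P, Finset.insert_subset hvQ hPQ, by simp [hvP, hPk],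
        fun i => H i ∪ S i, fun i => ?_, fun i j hij => ?_, fun i w hw => ?_, ?_⟩
      · rw [Finset.coe_union]
        exact induce_union_connected_of_forall_adj (hHc i) fun w hw => (hSH i w hw).2
      · beta_reduce
        rw [Finset.disjoint_union_left, Finset.disjoint_union_right,
          Finset.disjoint_union_right]
        exact ⟨⟨hHd hij, hHS i j⟩, (hHS j i).symm, hSd hij⟩
      · rcases Finset.mem_union.1 hw with hw | hw
        · exact Finset.mem_insert_of_mem (hHP i w hw)
        · exact (hSH i w hw).1 ▸ Finset.mem_insert_self _ _
      · intro c hc I hI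
        rcases Finset.mem_insert.1 hc with rfl | hc
        · refine (hSm I hI).trans_le (Nat.mul_le_mul_left _ (Finset.card_le_card ?_))
          intro w hw
          obtain ⟨i, hi, hwi⟩ := Finset.mem_biUnion.1 hw
          exact Finset.mem_filter.2 ⟨Finset.mem_biUnion.2
            ⟨i, hi, Finset.mem_union_right _ hwi⟩, (hSH i w hwi).1⟩
        · refine (hHm c hc I hI).trans_le (Nat.mul_le_mul_left _ (Finset.card_le_card ?_))
          exact Finset.filter_subset_filter _
            (Finset.biUnion_mono fun i _ => Finset.subset_union_left)
  obtain ⟨P, hPQ, hPk, H, hHc, hHd, hHP, hHm⟩ := grow Q.card hQ.card_pos le_rfl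
  obtain rfl := Finset.eq_of_subset_of_card_le hPQ hPk.ge
  refine ⟨H, hHc, hHd, hHP, fun i c hc => ?_⟩
  -- For a single set the invariant reads `0 < m * _`, so that set meets the class.
  have := hHm c hc {i} (by simp)
  obtain ⟨w, hw⟩ := Finset.card_pos.1 
    (Nat.pos_of_mul_pos_left (Nat.zero_lt_of_lt this))
  exact ⟨w, by simpa using hw⟩

end Equitable

end SimpleGraph

/-! ### Properties of the stable colorings -/

namespace WL

namespace Coloring

theorem Refines.trans {α : Type u} {a b c : Coloring α} (h₁ : a.Refines b) (h₂ : b.Refines c) :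
    a.Refines c :=
  fun v w h => h₂ v w (h₁ v w h)

end Coloring

theorem iter_succ_refines {V : Type u} [Fintype V] (k : ℕ) (G : SimpleGraph V) (χ : Coloring V)
    (i : ℕ) : (iter k G χ (i + 1)).Refines (iter k G χ i) :=
  fun _ _ h => congrArg Prod.fst h

theorem iter_refines_init {V : Type u} [Fintype V] (k : ℕ) (G : SimpleGraph V) (χ : Coloring V)
    (i : ℕ) : (iter k G χ i).Refines (init k G χ) := by
  induction i with
  | zero => exact fun _ _ h => h
  | succ i ih => exact (iter_succ_refines k G χ i).trans ih

theorem stable_refines_init {V : Type u} [Fintype V] (k : ℕ) (G : SimpleGraph V)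
    (χ : Coloring V) : (stable k G χ).Refines (init k G χ) :=
  iter_refines_init k G χ _

theorem stable_refines_round {V : Type u} [Fintype V] (k : ℕ) (G : SimpleGraph V)
    (χ : Coloring V) : (stable k G χ).Refines (round k (stable k G χ)) := by
  obtain ⟨n, hn⟩ := Coloring.exists_stationary (iter k G χ) (iter_succ_refines k G χ)
  have hne : {i | (iter k G χ i).Equivalent (iter k G χ (i + 1))}.Nonempty :=
    ⟨n, hn (n + 1) n.le_succ⟩
  exact (Nat.sInf_mem hne).1

theorem diagStep_refines {V : Type u} [Fintype V] {k : ℕ} [NeZero k] (G : SimpleGraph V)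
    (χ : Coloring V) : (diagStep k G χ).Refines χ :=
  fun _ _ h => congrFun (congrArg Prod.snd (stable_refines_init k G χ _ _ h)) 0

theorem splitStep_refines {V : Type u} (t : ℕ) (χ : Coloring V) :
    (splitStep t χ).Refines χ := by
  intro v w h
  simp only [splitStep] at h
  split_ifs at h with h1 h2
  · rw [Sum.inl.inj h]
  · exact Sum.inr.inj h

theorem tkSeq_succ_refines {V : Type u} [Fintype V] (t : ℕ) {k : ℕ} [NeZero k]
    (G : SimpleGraph V) (χ : Coloring V) (n : ℕ) :
    (tkSeq t k G χ (n + 1)).Refines (tkSeq t k G χ n) := by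
  rw [tkSeq]
  split_ifs
  · exact diagStep_refines G _
  · exact splitStep_refines t _

/-- Neither operation changes the partition of the `(t,k)`-stable coloring. -/
theorem exists_equivalent_tkStable {V : Type u} [Fintype V] (t : ℕ) {k : ℕ} [NeZero k]
    (G : SimpleGraph V) (χ : Coloring V) :
    (∃ χ', χ'.Equivalent (tkStable t k G χ) ∧
      (tkStable t k G χ).Refines (diagStep k G χ')) ∧
    ∃ χ', χ'.Equivalent (tkStable t k G χ) ∧
      (tkStable t k G χ).Refines (splitStep t χ') := by
  obtain ⟨N, hN⟩ := Coloring.exists_stationary (tkSeq t k G χ) (tkSeq_succ_refines t G χ)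
  have hne : {n | (tkSeq t k G χ n).Equivalent (tkSeq t k G χ (n + 1)) ∧
      (tkSeq t k G χ (n + 1)).Equivalent (tkSeq t k G χ (n + 2))}.Nonempty :=
    ⟨N, hN _ (by omega), (hN (N + 1) (by omega)).2.trans (hN (N + 2) (by omega)).1,
      (hN (N + 2) (by omega)).2.trans (hN (N + 1) (by omega)).1⟩
  obtain ⟨h1, h2⟩ := Nat.sInf_mem hne
  rw [tkStable]
  generalize sInf {n | (tkSeq t k G χ n).Equivalent (tkSeq t k G χ (n + 1)) ∧
    (tkSeq t k G χ (n + 1)).Equivalent (tkSeq t k G χ (n + 2))} = n at h1 h2 ⊢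
  have h0 : (tkSeq t k G χ n).Equivalent (tkSeq t k G χ n) := ⟨fun _ _ h => h, fun _ _ h => h⟩
  have hs1 : tkSeq t k G χ (n + 1) = if Even n then diagStep k G (tkSeq t k G χ n)
    else splitStep t (tkSeq t k G χ n) := rfl
  have hs2 : tkSeq t k G χ (n + 2) = if Even (n + 1) then diagStep k G (tkSeq t k G χ (n + 1))
    else splitStep t (tkSeq t k G χ (n + 1)) := rfl
  have h3 := h1.1.trans h2.1
  -- Parity decides which operation acts on `χ_n`; the other acts on the equivalent `χ_{n+1}`, hence
  -- the auxiliary `χ'`.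
  rcases Nat.even_or_odd n with hn | hn
  · rw [if_pos hn] at hs1
    rw [if_neg (by simpa [Nat.even_add_one] using hn)] at hs2
    exact ⟨⟨_, h0, hs1 ▸ h1.1⟩, _, h1.symm, hs2 ▸ h3⟩
  · rw [if_neg (by simpa using hn)] at hs1
    rw [if_pos (by simpa [Nat.even_add_one] using hn)] at hs2
    exact ⟨⟨_, h1.symm, hs2 ▸ h3⟩, _, h0, hs1 ▸ h1.1⟩

/-- One more round at the diagonal pair `(u, u)` records the multiset of colors of the pairs `(u,
w)`, and such a color determines both whether `u` and `w` are adjacent and the color of `w`. -/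
theorem tkStable_isEquitable {V : Type u} [Fintype V] (t : ℕ) (G : SimpleGraph V)
    (χ : Coloring V) : G.IsEquitable (tkStable t 2 G χ).color := by
  classical
  obtain ⟨⟨χ', hχ', hdiag⟩, -⟩ := exists_equivalent_tkStable t (k := 2) G χ
  intro u u' huu' d
  have hmul := congrArg Prod.snd (stable_refines_round 2 G χ' _ _ (hdiag u u' huu'))
  simp only [round] at hmul
  let R : (Fin 2 → (stable 2 G χ').Color) → Prop := fun x =>
    ∃ p : Fin 2 → V, (stable 2 G χ').color p = x 1 ∧
      (tkStable t 2 G χ).color (p 1) = d ∧ G.Adj (p 0) (p 1)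
  have hR : ∀ u w, ((tkStable t 2 G χ).color w = d ∧ G.Adj u w) ↔
      R fun i => (stable 2 G χ').color (Function.update (fun _ => u) i w) := by
    intro u w
    constructor
    · rintro ⟨h1, h2⟩
      exact ⟨_, rfl, by simpa using h1, by simpa using h2⟩
    · rintro ⟨p, hp, h1, h2⟩
      have hinit := stable_refines_init 2 G χ' _ _ hp
      have hadj : G.Adj (p 0) (p 1) = G.Adj u w := by
        simpa [init] using congrArg Prod.snd (congrFun (congrFun (congrArg Prod.fst hinit) 0) 1)
      have hcol : χ'.color (p 1) = χ'.color w := by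
        simpa [init] using congrFun (congrArg Prod.snd hinit) 1
      exact ⟨(hχ'.1 _ _ hcol).symm.trans h1, hadj ▸ h2⟩
  have hcount := congrArg (Multiset.countP R) hmul
  rw [Multiset.countP_map, Multiset.countP_map] at hcount
  simp only [hR]
  exact hcount

theorem cls_tkStable_eq_singleton {V : Type u} [Fintype V] (t : ℕ) {k : ℕ} [NeZero k]
    (G : SimpleGraph V) (χ : Coloring V) (v : V)
    (hv : ((tkStable t k G χ).cls v).ncard ≤ t) : (tkStable t k G χ).cls v = {v} := by
  classical
  obtain ⟨-, χ', hχ', hsplit⟩ := exists_equivalent_tkStable t (k := k) G χ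
  have hcls : ∀ w, χ'.cls w = (tkStable t k G χ).cls w := fun w =>
    Set.ext fun x => ⟨hχ'.1 x w, hχ'.2 x w⟩
  ext w
  refine ⟨fun hw => ?_, fun hw => hw ▸ rfl⟩
  have h := hsplit w v hw
  have hwv : (tkStable t k G χ).cls w = (tkStable t k G χ).cls v :=
    Set.ext fun x => by
      change _ = _ ↔ _ = _
      rw [show (tkStable t k G χ).color w = _ from hw]
  simp only [splitStep, hcls, hwv, if_pos hv] at h
  exact Sum.inl.inj h

end WL

/-! ### The minor model -/

theorem mainTheorem4 {V : Type u} [Fintype V] (G : SimpleGraph V) (h : ℕ)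
    (hG : ¬ G.HasMinor (completeBipartiteGraph (Fin 3) (Fin h)))
    (X : Set V) (Z : (G.induce (WL.closure 2 2 G X)ᶜ).ConnectedComponent) :
    (G.openNbhd (Subtype.val '' Z.supp)).ncard < h := by
  classical
  by_contra! hh
  apply hG
  set χ := WL.tkStable 2 2 G (WL.individualize X) with hχ
  have hf : G.IsEquitable χ.color := WL.tkStable_isEquitable 2 G _
  have hD : ∀ v, v ∈ WL.closure 2 2 G X ↔ (χ.cls v).ncard = 1 := fun v => Iff.rfl
  have hcls : ∀ v, (SimpleGraph.colorFinset χ.color (χ.color v)).card = (χ.cls v).ncard := by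
    intro v
    rw [← Set.ncard_coe_finset]
    congr 1
    ext w
    simp [WL.Coloring.cls]
  have hlarge : ∀ v ∉ WL.closure 2 2 G X, 3 ≤ (χ.cls v).ncard := by
    intro v hv
    by_contra hlt
    rw [hD, WL.cls_tkStable_eq_singleton 2 G _ v (Nat.le_of_lt_succ (not_le.1 hlt))] at hv
    simp at hv
  let Q : Finset χ.Color := (Finset.univ.filter fun v => v ∈ Subtype.val '' Z.supp).image χ.color
  have hQ : ∀ c, c ∈ Q ↔ ∃ z ∈ Z.supp, χ.color z.1 = c := by
    intro c
    simp [Q]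
  obtain ⟨z₀, hz₀⟩ := Z.nonempty_supp
  obtain ⟨H, hHc, hHd, hHQ, hHm⟩ := hf.exists_three_connected Q ⟨_, (hQ _).2 ⟨z₀, hz₀, rfl⟩⟩
    (fun c hc => by
      obtain ⟨z, -, rfl⟩ := (hQ c).1 hc
      rw [hcls]
      exact hlarge z z.2)
    (fun P hPQ hne ⟨c, hc⟩ => by
      obtain ⟨c', hc'Q, hc'P⟩ := Finset.exists_of_ssubset (hPQ.ssubset_of_ne hne)
      obtain ⟨z, hz, rfl⟩ := (hQ c).1 (hPQ hc)
      obtain ⟨z', hz', rfl⟩ := (hQ c').1 hc'Q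
      -- A walk inside `Z` from a color in `P` to one outside has an edge leaving `P`.
      obtain ⟨p⟩ := SimpleGraph.ConnectedComponent.exact (hz.trans hz'.symm)
      obtain ⟨d, -, hd1, hd2⟩ := p.exists_boundary_dart
        {x | x ∈ Z.supp ∧ χ.color x.1 ∈ P} ⟨hz, hc⟩ fun h => hc'P h.2
      have hdZ : d.snd ∈ Z.supp := (Z.mem_supp_congr_adj d.adj).1 hd1.1
      exact ⟨d.fst, d.snd, d.adj, hd1.2, (hQ _).2 ⟨_, hdZ, rfl⟩, fun h => hd2 ⟨hdZ, h⟩⟩)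
  obtain ⟨N, hN, hNh⟩ := Set.exists_subset_card_eq hh
  obtain ⟨e⟩ : Nonempty (Fin h ≃ N) := ⟨(Fintype.equivFinOfCardEq
    (by rw [← Nat.card_eq_fintype_card, Nat.card_coe_set_eq, hNh])).symm⟩
  have hND : ∀ y ∈ N, y ∈ WL.closure 2 2 G X := by
    intro y hy
    obtain ⟨hyZ, _, ⟨z, hz, rfl⟩, hzy⟩ := hN hy
    by_contra hyD
    have hadj : (G.induce (WL.closure 2 2 G X)ᶜ).Adj z ⟨y, hyD⟩ := hzy
    exact hyZ ⟨⟨y, hyD⟩, (Z.mem_supp_congr_adj hadj).1 hz, rfl⟩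
  have hHD : ∀ i, ∀ w ∈ H i, w ∉ WL.closure 2 2 G X := by
    intro i w hw hwD
    obtain ⟨z, -, hzw⟩ := (hQ _).1 (hHQ i w hw)
    have h1 := hlarge z z.2
    rw [hD, ← hcls, ← hzw, hcls] at hwD
    omega
  have hHN : ∀ i, ∀ y ∈ N, ∃ w ∈ H i, G.Adj w y := by
    intro i y hy
    obtain ⟨-, _, ⟨z, hz, rfl⟩, hzy⟩ := hN hy
    obtain ⟨w, hw, hwz⟩ := hHm i _ ((hQ _).2 ⟨z, hz, rfl⟩)
    obtain ⟨y', hy', hwy'⟩ := hf.exists_adj hwz.symm hzy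
    obtain ⟨a, ha⟩ := Set.ncard_eq_one.1 ((hD y).1 (hND y hy))
    have h1 : y ∈ χ.cls y := rfl
    have h2 : y' ∈ χ.cls y := hy'
    rw [ha] at h1 h2
    exact ⟨w, hw, (h2.trans h1.symm : y' = y) ▸ hwy'⟩
  refine ⟨Sum.elim (fun i => (H i : Set V)) fun j => {(e j : V)}, ?_, ?_, ?_⟩
  · rintro (i | j)
    · exact hHc i
    · exact SimpleGraph.connected_induce_singleton _
  · rintro (i | j) (i' | j') hne
    · exact Finset.disjoint_coe.2 (hHd fun h => hne (congrArg _ h))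
    · exact Set.disjoint_singleton_right.2 fun hw => hHD i _ hw (hND _ (e j').2)
    · exact Set.disjoint_singleton_left.2 fun hw => hHD i' _ hw (hND _ (e j).2)
    · exact Set.disjoint_singleton.2 fun h =>
        hne (congrArg _ (e.injective (Subtype.ext h)))
  · rintro (i | j) (i' | j') hadj
    · simp at hadj
    · obtain ⟨w, hw, hwy⟩ := hHN i _ (e j').2
      exact ⟨w, hw, _, rfl, hwy⟩
    · obtain ⟨w, hw, hwy⟩ := hHN i' _ (e j).2
      exact ⟨_, rfl, w, hw, hwy.symm⟩
    · simp at hadj
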